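/- Let $\mathbb K\in\{\mathbb R,\mathbb C\}$, let $X$ be a metric space with base point $0$, and let $E,F$ be Banach spaces over $\mathbb K$. Let $X^{\#}=\mathrm{Lip}_0(X;\mathbb K)$ be the space of Lipschitz functions $f:X\to\mathbb K$ with $f(0)=0$, normed by the Lipschitz constant, with closed unit ball $B_{X^\#}$; put $\delta_x(f)=f(x)$ and let $\mathcal F(X)=\overline{\mathrm{span}}\{\delta_x:x\in X\}\subset (X^{\#})^*$ be the Lipschitz-free space. Let $LipL_0(X\times E;F)$ be the space of Lip-Linear operators $T:X\times E\to F$ with $T(0,\cdot)=0$, that is, $T(x,\cdot)$ is linear for every $x$ and, for some $C>0$, $\|T(x,e)-T(y,e)\|\le C\,d(x,y)\|e\|$ for all $x,y\in X$, $e\in E$. For such $T$ let $T_{bil}:\mathcal F(X)\times E\to F$ be the unique continuous bilinear operator with $T_{bil}(\delta_x,e)=T(x,e)$. $T\in LipL_0(X\times E;F)$ is called integral if there is $C>0$ such that for all $n$, $x_i,y_i\in X$, $e_i\in E$, $z_i^*\in F^*$ ($1\le i\le n$), $$\Big|\sum_{i=1}^n\langle T(x_i,e_i)-T(y_i,e_i),z_i^*\rangle\Big|\le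 C\sup_{f\in B_{X^{\#}},\,\|e^*\|=1}\Big\|\sum_{i=1}^n (f(x_i)-f(y_i))\,e^*(e_i)\,z_i^*\Big\|_{F^*};$$ $\mathfrak I^{LipL}_{int}(T)$ is the infimum of these $C$, and $LipL_0^{int}(X\times E;F)$ is the space of integral operators with this norm. A continuous bilinear operator $B:G\times E\to F$ ($G$ a Banach space) is called integral if there is $C>0$ such that for all $n$, $x_i\in G$, $e_i\in E$, $z_i^*\in F^*$, $$\Big|\sum_{i=1}^n\langle B(x_i,e_i),z_i^*\rangle\Big|\le C\sup_{x^*\in B_{G^*},\,e^*\in B_{E^*}}\Big\|\sum_{i=1}^n x^*(x_i)\,e^*(e_i)\,z_i^*\Big\|_{F^*};$$ $\mathfrak I^{2}_{int}(B)$ is the infimum of these $C$, and $\mathcal{BI}(G\times E;F)$ is the space of integral bilinear operators with this norm. Let $X\boxtimes E$ be the span of the functionals $\delta_{(x,y)}\boxtimes e: g\mapsto\langle g(x)-g(y),e\rangle$ on $\mathrm{Lip}_0(X;E^*)$, and let $X\widehat\boxtimes_\varepsilon E$ be its completion for the norm $\varepsilon\big(\sum_i\delta_{(x_i,y_i)}\boxtimes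 e_i\big)=\sup_{f\in B_{X^\#},\,\|e^*\|=1}\big|\sum_i(f(x_i)-f(y_i))e^*(e_i)\big|$. Then: 1. A Lip-Linear operator $T\in LipL_0(X\times E;F)$ is integral if and only if $T_{bil}$ is an integral bilinear operator, and in this case $\mathfrak I^{LipL}_{int}(T)=\mathfrak I^2_{int}(T_{bil})$. 2. The map $T\mapsto T_{bil}$ is a linear isometric bijection of $LipL_0^{int}(X\times E;F)$ onto $\mathcal{BI}(\mathcal F(X)\times E;F)$. 3. In particular, $(X\widehat\boxtimes_\varepsilon E)^*=LipL_0^{int}(X\times E;\mathbb K)$: the map sending a functional $\varphi$ to $(x,e)\mapsto\varphi(\delta_{(x,0)}\boxtimes e)$ is a linear isometric bijection of $(X\widehat\boxtimes_\varepsilon E)^*$ onto $LipL_0^{int}(X\times E;\mathbb K)$. -/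

import Mathlib

noncomputable section

namespace LipLin

/-! ## Norms given as the least admissible constant -/

/-- The infimum of the admissible constants `C > 0` is a norm as soon as the relation
"`C` is admissible for `v`" satisfies the obvious homogeneity and subadditivity rules. -/
theorem core_sInf {𝕜 V : Type*} [RCLike 𝕜] [AddCommGroup V] [Module 𝕜 V] [Norm V]
    (P : V → ℝ → Prop) (hnorm : ∀ v, ‖v‖ = sInf {C : ℝ | 0 < C ∧ P v C})
    (hex : ∀ v, ∃ C, 0 < C ∧ P v C)
    (hadd : ∀ v w C D, P v C → P w D → P (v + w) (C + D))
    (hsmul : ∀ (c : 𝕜) v C, P v C → P (c • v) (‖c‖ * C))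
    (hmono : ∀ v C D, C ≤ D → P v C → P v D)
    (hzero : ∀ v, (∀ C, 0 < C → P v C) → v = 0) : NormedSpace.Core 𝕜 V := by
  have hbdd : ∀ v, BddBelow {C : ℝ | 0 < C ∧ P v C} := fun v => ⟨0, fun C hC => hC.1.le⟩
  have hne : ∀ v, {C : ℝ | 0 < C ∧ P v C}.Nonempty := hex
  have hnn : ∀ v : V, 0 ≤ ‖v‖ := fun v => by
    rw [hnorm]; exact Real.sInf_nonneg fun C hC => hC.1.le
  have happ : ∀ v C, ‖v‖ < C → P v C := fun v C h => by
    rw [hnorm] at h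
    obtain ⟨D, hD, hDC⟩ := exists_lt_of_csInf_lt (hne v) h
    exact hmono v D C hDC.le hD.2
  have hle : ∀ v C, 0 < C → P v C → ‖v‖ ≤ C := fun v C h0 h => by
    rw [hnorm]; exact csInf_le (hbdd v) ⟨h0, h⟩
  have hle' : ∀ v C, 0 ≤ C → P v C → ‖v‖ ≤ C := fun v C h0 h =>
    le_of_forall_pos_le_add fun ε hε =>
      hle v (C + ε) (by linarith) (hmono v C _ (by linarith) h)
  have hz0 : ‖(0 : V)‖ = 0 := by
    obtain ⟨C, _, hC⟩ := hex 0
    have h := hsmul 0 0 C hC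
    rw [norm_zero, zero_mul, smul_zero] at h
    exact le_antisymm (hle' 0 0 le_rfl h) (hnn 0)
  have hsm : ∀ (c : 𝕜) (v : V), ‖c • v‖ ≤ ‖c‖ * ‖v‖ := fun c v => by
    refine le_of_forall_pos_le_add fun ε hε => ?_
    have hpos : 0 < ‖c‖ + 1 := by positivity
    have hd : 0 < ε / (‖c‖ + 1) := by positivity
    have h := hsmul c v (‖v‖ + ε / (‖c‖ + 1)) (happ v _ (by linarith))
    refine (hle' _ _ (by have := hnn v; positivity) h).trans ?_
    rw [mul_add]
    have : ‖c‖ * (ε / (‖c‖ + 1)) ≤ ε := by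
      rw [mul_div_assoc', div_le_iff₀ hpos]
      nlinarith [norm_nonneg c]
    linarith
  refine { norm_nonneg := hnn, norm_smul := fun c v => ?_, norm_triangle := fun v w => ?_,
           norm_eq_zero_iff := fun v => ⟨fun h => ?_, fun h => by rw [h, hz0]⟩ }
  · refine le_antisymm (hsm c v) ?_
    by_cases hc : c = 0
    · simp [hc, hnn]
    · have h := hsm c⁻¹ (c • v)
      rw [smul_smul, inv_mul_cancel₀ hc, one_smul, norm_inv] at h
      have hc' : 0 < ‖c‖ := norm_pos_iff.mpr hc
      calc ‖c‖ * ‖v‖ ≤ ‖c‖ * (‖c‖⁻¹ * ‖c • v‖) := by gcongr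
        _ = ‖c • v‖ := by field_simp
  · refine le_of_forall_pos_le_add fun ε hε => ?_
    have h := hadd v w (‖v‖ + ε / 2) (‖w‖ + ε / 2) (happ v _ (by linarith))
      (happ w _ (by linarith))
    refine (hle' _ _ (by have := hnn v; have := hnn w; positivity) h).trans (by linarith)
  · exact hzero v fun C hC => happ v C (by rw [h]; exact hC)

/-! ## Lipschitz maps vanishing at the base point

A pointed metric space is a metric space `X` with a distinguished point `0`
(`[MetricSpace X] [Zero X]`). -/

section Lip

variable (𝕜 X G : Type*) [RCLike 𝕜] [MetricSpace X] [Zero X]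
  [NormedAddCommGroup G] [NormedSpace 𝕜 G]

/-- Lipschitz maps `X → G` vanishing at `0`, as a linear subspace of all maps. -/
def lipZeroSubmodule : Submodule 𝕜 (X → G) where
  carrier := {f | f 0 = 0 ∧ ∃ K : ℝ, ∀ x y, ‖f x - f y‖ ≤ K * dist x y}
  zero_mem' := ⟨rfl, 0, by simp⟩
  add_mem' := by
    rintro f g ⟨hf, K, hK⟩ ⟨hg, L, hL⟩
    refine ⟨by simp [hf, hg], K + L, fun x y => ?_⟩
    calc ‖(f + g) x - (f + g) y‖ = ‖(f x - f y) + (g x - g y)‖ := by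
          simp only [Pi.add_apply]; congr 1; abel
      _ ≤ ‖f x - f y‖ + ‖g x - g y‖ := norm_add_le _ _
      _ ≤ (K + L) * dist x y := by rw [add_mul]; exact add_le_add (hK x y) (hL x y)
  smul_mem' := by
    rintro c f ⟨hf, K, hK⟩
    refine ⟨by simp [hf], ‖c‖ * K, fun x y => ?_⟩
    rw [Pi.smul_apply, Pi.smul_apply, ← smul_sub, norm_smul, mul_assoc]
    exact mul_le_mul_of_nonneg_left (hK x y) (norm_nonneg c)

/-- The space `Lip₀(X; G)`; it carries the Lipschitz norm below. -/
def LipZero : Type _ := lipZeroSubmodule 𝕜 X G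

instance : AddCommGroup (LipZero 𝕜 X G) := inferInstanceAs (AddCommGroup (lipZeroSubmodule 𝕜 X G))
instance : Module 𝕜 (LipZero 𝕜 X G) := inferInstanceAs (Module 𝕜 (lipZeroSubmodule 𝕜 X G))
instance : FunLike (LipZero 𝕜 X G) X G := ⟨fun f => f.1, Subtype.val_injective⟩

variable {𝕜 X G}

@[ext] theorem LipZero.ext {f g : LipZero 𝕜 X G} (h : ∀ x, f x = g x) : f = g :=
  DFunLike.ext f g h

/-- A Lipschitz map vanishing at `0`, as an element of `Lip₀(X; G)`. -/
def LipZero.mk (f : X → G) (h0 : f 0 = 0) (K : ℝ) (h : ∀ x y, ‖f x - f y‖ ≤ K * dist x y) :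
    LipZero 𝕜 X G := ⟨f, h0, K, h⟩

@[simp] theorem LipZero.mk_apply (f : X → G) (h0 : f 0 = 0) (K : ℝ)
    (h : ∀ x y, ‖f x - f y‖ ≤ K * dist x y) (x : X) :
    (LipZero.mk f h0 K h : LipZero 𝕜 X G) x = f x := rfl

@[simp] theorem LipZero.add_apply (f g : LipZero 𝕜 X G) (x : X) : (f + g) x = f x + g x := rfl
@[simp] theorem LipZero.smul_apply (c : 𝕜) (f : LipZero 𝕜 X G) (x : X) : (c • f) x = c • f x := rfl
@[simp] theorem LipZero.zero_apply (x : X) : (0 : LipZero 𝕜 X G) x = 0 := rfl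
@[simp] theorem LipZero.map_zero (f : LipZero 𝕜 X G) : f 0 = 0 := f.2.1

/-- `Lip(f) = sup_{x ≠ y} ‖f x - f y‖ / d(x, y)`; the pairs with `x = y` contribute `0 / 0 = 0`. -/
instance : Norm (LipZero 𝕜 X G) := ⟨fun f => ⨆ p : X × X, ‖f p.1 - f p.2‖ / dist p.1 p.2⟩

theorem LipZero.norm_def (f : LipZero 𝕜 X G) :
    ‖f‖ = ⨆ p : X × X, ‖f p.1 - f p.2‖ / dist p.1 p.2 := rfl

theorem LipZero.bdd (f : LipZero 𝕜 X G) :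
    BddAbove (Set.range fun p : X × X => ‖f p.1 - f p.2‖ / dist p.1 p.2) := by
  obtain ⟨_, K, hK⟩ := f.2
  refine ⟨max K 0, ?_⟩
  rintro _ ⟨⟨x, y⟩, rfl⟩
  refine div_le_of_le_mul₀ dist_nonneg (le_max_right _ _) ((hK x y).trans ?_)
  exact mul_le_mul_of_nonneg_right (le_max_left _ _) dist_nonneg

theorem LipZero.norm_sub_le (f : LipZero 𝕜 X G) (x y : X) :
    ‖f x - f y‖ ≤ ‖f‖ * dist x y := by
  by_cases h : x = y
  · subst h; simp
  · have hd : 0 < dist x y := dist_pos.mpr h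
    exact (div_le_iff₀ hd).mp (le_ciSup f.bdd (x, y))

theorem LipZero.nonneg (f : LipZero 𝕜 X G) : 0 ≤ ‖f‖ :=
  Real.iSup_nonneg fun _ => div_nonneg (norm_nonneg _) dist_nonneg

theorem LipZero.norm_le (f : LipZero 𝕜 X G) {C : ℝ} (hC : 0 ≤ C)
    (h : ∀ x y, ‖f x - f y‖ ≤ C * dist x y) : ‖f‖ ≤ C :=
  ciSup_le fun p => div_le_of_le_mul₀ dist_nonneg hC (h p.1 p.2)

theorem LipZero.core : NormedSpace.Core 𝕜 (LipZero 𝕜 X G) where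
  norm_nonneg := LipZero.nonneg
  norm_smul c f := by
    rw [LipZero.norm_def, LipZero.norm_def, Real.mul_iSup_of_nonneg (norm_nonneg c)]
    congr 1; ext p
    rw [LipZero.smul_apply, LipZero.smul_apply, ← smul_sub, norm_smul, mul_div_assoc]
  norm_triangle f g := by
    refine LipZero.norm_le _ (add_nonneg f.nonneg g.nonneg) fun x y => ?_
    calc ‖(f + g) x - (f + g) y‖ = ‖(f x - f y) + (g x - g y)‖ := by
          simp only [LipZero.add_apply]; congr 1; abel
      _ ≤ ‖f x - f y‖ + ‖g x - g y‖ := norm_add_le _ _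
      _ ≤ _ := by rw [add_mul]; exact add_le_add (f.norm_sub_le x y) (g.norm_sub_le x y)
  norm_eq_zero_iff f := by
    refine ⟨fun h => LipZero.ext fun x => ?_, fun h => ?_⟩
    · have := f.norm_sub_le x 0
      rw [h, zero_mul, LipZero.map_zero, sub_zero] at this
      exact norm_le_zero_iff.mp this
    · subst h
      exact le_antisymm (LipZero.norm_le _ le_rfl (by simp)) (LipZero.nonneg _)

instance : NormedAddCommGroup (LipZero 𝕜 X G) := NormedAddCommGroup.ofCore LipZero.core
instance : NormedSpace 𝕜 (LipZero 𝕜 X G) := NormedSpace.ofCore LipZero.core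

end Lip

/-! ## The Lipschitz-free space -/

section Free

variable (𝕜 X : Type*) [RCLike 𝕜] [MetricSpace X] [Zero X]

variable {X} in
/-- The evaluation functional `δ_x` on `X^# = Lip₀(X; 𝕜)`. -/
def evalDual (x : X) : StrongDual 𝕜 (LipZero 𝕜 X 𝕜) :=
  LinearMap.mkContinuous
    { toFun := fun f => f x, map_add' := fun _ _ => rfl, map_smul' := fun _ _ => rfl }
    (dist x 0) (fun f => by
      have := f.norm_sub_le x 0
      rw [LipZero.map_zero, sub_zero] at this
      rw [mul_comm]; exact this)

/-- The closed linear span of the `δ_x` in `(X^#)*`. -/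
def freeSpace : Submodule 𝕜 (StrongDual 𝕜 (LipZero 𝕜 X 𝕜)) :=
  (Submodule.span 𝕜 (Set.range (evalDual 𝕜 (X := X)))).topologicalClosure

/-- The Lipschitz-free space `𝓕(X)`, with the norm of `(X^#)*`. -/
def LipFree : Type _ := freeSpace 𝕜 X

instance : NormedAddCommGroup (LipFree 𝕜 X) := inferInstanceAs (NormedAddCommGroup (freeSpace 𝕜 X))
instance : NormedSpace 𝕜 (LipFree 𝕜 X) := inferInstanceAs (NormedSpace 𝕜 (freeSpace 𝕜 X))

/-- The inclusion `𝓕(X) → (X^#)*`. -/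
def LipFree.incl : LipFree 𝕜 X →L[𝕜] StrongDual 𝕜 (LipZero 𝕜 X 𝕜) := (freeSpace 𝕜 X).subtypeL

variable {X} in
/-- The canonical map `δ_X : X → 𝓕(X)`. -/
def delta (x : X) : LipFree 𝕜 X :=
  ⟨evalDual 𝕜 x, Submodule.le_topologicalClosure _ (Submodule.subset_span ⟨x, rfl⟩)⟩

variable {𝕜 X} {G : Type*} [NormedAddCommGroup G] [NormedSpace 𝕜 G]

/-- Two continuous linear maps on `𝓕(X)` that agree on all `δ_x` are equal. -/
theorem freeSpace_ext {A B : LipFree 𝕜 X →L[𝕜] G} (h : ∀ x, A (delta 𝕜 x) = B (delta 𝕜 x)) :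
    A = B := by
  ext ⟨m, hm⟩
  have key : ∀ m ∈ Submodule.span 𝕜 (Set.range (evalDual 𝕜 (X := X))),
      ∀ hm : m ∈ freeSpace 𝕜 X, A ⟨m, hm⟩ = B ⟨m, hm⟩ := by
    intro m hm
    induction hm using Submodule.span_induction with
    | mem m h' => obtain ⟨x, rfl⟩ := h'; exact fun _ => h x
    | zero => intro _; exact (map_zero A).trans (map_zero B).symm
    | add a b ha hb iha ihb =>
      intro _
      have h1 := iha (Submodule.le_topologicalClosure _ ha)
      have h2 := ihb (Submodule.le_topologicalClosure _ hb)
      exact (map_add A ⟨a, _⟩ ⟨b, _⟩).trans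
        ((congrArg₂ (· + ·) h1 h2).trans (map_add B ⟨a, _⟩ ⟨b, _⟩).symm)
    | smul c a ha iha =>
      intro _
      have h1 := iha (Submodule.le_topologicalClosure _ ha)
      exact (map_smul A c ⟨a, _⟩).trans
        ((congrArg (c • ·) h1).trans (map_smul B c ⟨a, _⟩).symm)
  have hcl : IsClosed {m : LipFree 𝕜 X | A m = B m} := isClosed_eq A.continuous B.continuous
  have hm' := hm
  rw [freeSpace, ← SetLike.mem_coe, Submodule.topologicalClosure_coe, Metric.mem_closure_iff] at hm'
  refine hcl.closure_subset (Metric.mem_closure_iff.mpr fun ε hε => ?_)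
  obtain ⟨b, hb, hd⟩ := hm' ε hε
  exact ⟨⟨b, Submodule.le_topologicalClosure _ hb⟩, key b hb _, hd⟩

/-- Composition with `R ∈ Lip₀(X; G)`, as the operator `G* → X^#`, `z ↦ z ∘ R`. -/
def compDual (R : LipZero 𝕜 X G) : StrongDual 𝕜 G →L[𝕜] LipZero 𝕜 X 𝕜 :=
  LinearMap.mkContinuous
    { toFun := fun z => LipZero.mk (fun x => z (R x)) (by simp) (‖z‖ * ‖R‖) (fun x y => by
        rw [← map_sub, mul_assoc]
        exact (z.le_opNorm _).trans
          (mul_le_mul_of_nonneg_left (R.norm_sub_le x y) (norm_nonneg z)))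
      map_add' := fun _ _ => rfl
      map_smul' := fun _ _ => rfl }
    ‖R‖ (fun z => LipZero.norm_le _ (by positivity) fun x y => by
      change ‖z (R x) - z (R y)‖ ≤ _
      rw [← map_sub, mul_comm ‖R‖, mul_assoc]
      exact (z.le_opNorm _).trans
        (mul_le_mul_of_nonneg_left (R.norm_sub_le x y) (norm_nonneg z)))

/-- The linearization of `R` with values in the bidual: `m ↦ (z ↦ m (z ∘ R))`. -/
def bidualLin (R : LipZero 𝕜 X G) : LipFree 𝕜 X →L[𝕜] StrongDual 𝕜 (StrongDual 𝕜 G) :=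
  ((ContinuousLinearMap.compL 𝕜 (StrongDual 𝕜 G) (LipZero 𝕜 X 𝕜) 𝕜).flip (compDual R)).comp
    (LipFree.incl 𝕜 X)

theorem bidualLin_delta (R : LipZero 𝕜 X G) (x : X) :
    bidualLin R (delta 𝕜 x) = NormedSpace.inclusionInDoubleDualLi 𝕜 (R x) := rfl

theorem bidualLin_mem [CompleteSpace G] (R : LipZero 𝕜 X G) (m : LipFree 𝕜 X) :
    ∃ g : G, NormedSpace.inclusionInDoubleDualLi 𝕜 g = bidualLin R m := by
  let S := LinearMap.range (NormedSpace.inclusionInDoubleDualLi 𝕜 (E := G)).toLinearMap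
  have hS : IsClosed (S : Set (StrongDual 𝕜 (StrongDual 𝕜 G))) := by
    have := (NormedSpace.inclusionInDoubleDualLi 𝕜 (E := G)).isometry
    have h2 := this.isUniformInducing.isComplete_range.isClosed
    simpa [S, LinearMap.coe_range] using h2
  let Φ := (ContinuousLinearMap.compL 𝕜 (StrongDual 𝕜 G) (LipZero 𝕜 X 𝕜) 𝕜).flip (compDual R)
  have hle : freeSpace 𝕜 X ≤ S.comap Φ.toLinearMap := by
    refine Submodule.topologicalClosure_minimal _ ?_ (hS.preimage Φ.continuous)
    rw [Submodule.span_le]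
    rintro _ ⟨x, rfl⟩
    exact ⟨R x, rfl⟩
  exact hle m.2

/-- The linearization `R_L : 𝓕(X) → G` of `R ∈ Lip₀(X; G)`, for `G` complete: `R_L(m)` is the
element of `G` whose image in `G**` is `z ↦ m (z ∘ R)`. -/
def linearize [CompleteSpace G] (R : LipZero 𝕜 X G) : LipFree 𝕜 X →L[𝕜] G :=
  LinearMap.mkContinuous
    { toFun := fun m => (bidualLin_mem R m).choose
      map_add' := fun m m' => (NormedSpace.inclusionInDoubleDualLi 𝕜 (E := G)).injective <|
        (bidualLin_mem R (m + m')).choose_spec.trans <| (map_add (bidualLin R) m m').trans <|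
        (congrArg₂ (· + ·) (bidualLin_mem R m).choose_spec
          (bidualLin_mem R m').choose_spec).symm.trans (map_add _ _ _).symm
      map_smul' := fun c m => (NormedSpace.inclusionInDoubleDualLi 𝕜 (E := G)).injective <|
        (bidualLin_mem R (c • m)).choose_spec.trans <| (map_smul (bidualLin R) c m).trans <|
        (congrArg (c • ·) (bidualLin_mem R m).choose_spec).symm.trans (map_smul _ _ _).symm }
    ‖R‖ (fun m => NormedSpace.norm_le_dual_bound 𝕜 _ (by positivity) fun z => by
      have h : z (bidualLin_mem R m).choose = m.1 (compDual R z) :=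
        DFunLike.congr_fun (bidualLin_mem R m).choose_spec z
      have h2 : ‖compDual R z‖ ≤ ‖R‖ * ‖z‖ :=
        (compDual R).le_of_opNorm_le (LinearMap.mkContinuous_norm_le _ (norm_nonneg R) _) z
      change ‖z (bidualLin_mem R m).choose‖ ≤ _
      rw [h]
      refine (m.1.le_opNorm _).trans ?_
      calc ‖m.1‖ * ‖compDual R z‖ ≤ ‖m.1‖ * (‖R‖ * ‖z‖) := by gcongr
        _ = ‖R‖ * ‖m.1‖ * ‖z‖ := by ring)

theorem linearize_delta [CompleteSpace G] (R : LipZero 𝕜 X G) (x : X) :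
    linearize R (delta 𝕜 x) = R x :=
  (NormedSpace.inclusionInDoubleDualLi 𝕜 (E := G)).injective
    ((bidualLin_mem R (delta 𝕜 x)).choose_spec.trans (bidualLin_delta R x))

end Free

/-! ## Lip-Linear operators -/

section LipLinear

variable (𝕜 X E F : Type*) [RCLike 𝕜] [MetricSpace X] [Zero X]
  [NormedAddCommGroup E] [NormedSpace 𝕜 E] [NormedAddCommGroup F] [NormedSpace 𝕜 F]

variable {X E F} in
/-- Lip-Linear operators `T : X × E → F`. -/
def IsLipLinear (T : X × E → F) : Prop :=
  (∃ C : ℝ, 0 < C ∧ ∀ (x y : X) (e : E), ‖T (x, e) - T (y, e)‖ ≤ C * dist x y * ‖e‖) ∧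
    ∀ x : X, IsLinearMap 𝕜 fun e : E => T (x, e)

/-- `LipL₀(X × E; F)`: the Lip-Linear operators with `T (0, e) = 0` for all `e`. -/
def LipLZero : Submodule 𝕜 (X × E → F) where
  carrier := {T | IsLipLinear 𝕜 T ∧ ∀ e : E, T (0, e) = 0}
  zero_mem' := ⟨⟨⟨1, one_pos, fun x y e => by simp; positivity⟩, fun _ => ⟨by simp, by simp⟩⟩,
    fun _ => rfl⟩
  add_mem' := by
    rintro S T ⟨⟨⟨C, hC, hS⟩, lS⟩, zS⟩ ⟨⟨⟨D, hD, hT⟩, lT⟩, zT⟩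
    refine ⟨⟨⟨C + D, by positivity, fun x y e => ?_⟩, fun x => ?_⟩, fun e => by simp [zS, zT]⟩
    · calc ‖(S + T) (x, e) - (S + T) (y, e)‖
          = ‖(S (x, e) - S (y, e)) + (T (x, e) - T (y, e))‖ := by
            simp only [Pi.add_apply]; congr 1; abel
        _ ≤ _ := norm_add_le _ _
        _ ≤ _ := add_le_add (hS x y e) (hT x y e)
        _ = _ := by ring
    · exact ((lS x).mk' _ + (lT x).mk' _).isLinear
  smul_mem' := by
    rintro c T ⟨⟨⟨D, hD, hT⟩, lT⟩, zT⟩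
    refine ⟨⟨⟨(‖c‖ + 1) * D, by positivity, fun x y e => ?_⟩, fun x => ?_⟩, fun e => by simp [zT]⟩
    · rw [Pi.smul_apply, Pi.smul_apply, ← smul_sub, norm_smul]
      calc ‖c‖ * ‖T (x, e) - T (y, e)‖ ≤ (‖c‖ + 1) * (D * dist x y * ‖e‖) :=
            mul_le_mul (by linarith) (hT x y e) (norm_nonneg _) (by positivity)
        _ = _ := by ring
    · exact (c • (lT x).mk' _).isLinear

variable {𝕜 X E F}

/-- `x ↦ T(x, ·)`, as an element of `Lip₀(X; 𝓛(E; F))`. -/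
def curryLip (T : LipLZero 𝕜 X E F) : LipZero 𝕜 X (E →L[𝕜] F) :=
  ⟨fun x => LinearMap.mkContinuousOfExistsBound ((T.2.1.2 x).mk' _) (by
      obtain ⟨C, hC, h⟩ := T.2.1.1
      refine ⟨C * dist x 0, fun e => ?_⟩
      have := h x 0 e
      rw [T.2.2 e, sub_zero] at this
      exact this),
    by ext e; exact T.2.2 e, by
      obtain ⟨C, hC, h⟩ := T.2.1.1
      exact ⟨C, fun x y => ContinuousLinearMap.opNorm_le_bound _ (by positivity) fun e => h x y e⟩⟩

/-- The bilinear operator `T_bil : 𝓕(X) × E → F` associated with `T`; it is the only continuous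
bilinear operator with `T_bil(δ_x, e) = T(x, e)` (see the next two facts). -/
def Tbil [CompleteSpace F] (T : LipLZero 𝕜 X E F) : LipFree 𝕜 X →L[𝕜] E →L[𝕜] F :=
  linearize (curryLip T)

theorem Tbil_delta [CompleteSpace F] (T : LipLZero 𝕜 X E F) (x : X) (e : E) :
    Tbil T (delta 𝕜 x) e = T.1 (x, e) := by
  rw [Tbil, linearize_delta]; rfl

theorem Tbil_unique [CompleteSpace F] (T : LipLZero 𝕜 X E F)
    (B : LipFree 𝕜 X →L[𝕜] E →L[𝕜] F) (hB : ∀ x e, B (delta 𝕜 x) e = T.1 (x, e)) :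
    B = Tbil T :=
  freeSpace_ext fun x => by ext e; rw [hB, Tbil_delta]

/-! ### Integral Lip-Linear operators -/

/-- `sup ‖∑ᵢ (f(xᵢ) - f(yᵢ)) e*(eᵢ) zᵢ*‖` over `f ∈ B_{X^#}` and `‖e*‖ = 1`. -/
def lipWeakSup {n : ℕ} (x y : Fin n → X) (e : Fin n → E) (z : Fin n → StrongDual 𝕜 F) : ℝ :=
  ⨆ p : {f : LipZero 𝕜 X 𝕜 // ‖f‖ ≤ 1} × {φ : StrongDual 𝕜 E // ‖φ‖ = 1},
    ‖∑ i, ((p.1.1 (x i) - p.1.1 (y i)) * p.2.1 (e i)) • z i‖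

variable (𝕜) in
/-- `C` satisfies the inequality that defines integrality of `T : X × E → F`. -/
def LipLIntBound (T : X × E → F) (C : ℝ) : Prop :=
  ∀ (n : ℕ) (x y : Fin n → X) (e : Fin n → E) (z : Fin n → StrongDual 𝕜 F),
    ‖∑ i, z i (T (x i, e i) - T (y i, e i))‖ ≤ C * lipWeakSup x y e z

variable (𝕜) in
/-- Integrality of a Lip-Linear operator. -/
def IsLipLIntegral (T : X × E → F) : Prop := ∃ C : ℝ, 0 < C ∧ LipLIntBound 𝕜 T C

variable (𝕜) in
/-- `𝔍_int^{LipL}(T)`. -/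
def lipLIntNorm (T : X × E → F) : ℝ := sInf {C : ℝ | 0 < C ∧ LipLIntBound 𝕜 T C}

theorem lipWeakSup_nonneg {n : ℕ} (x y : Fin n → X) (e : Fin n → E)
    (z : Fin n → StrongDual 𝕜 F) : 0 ≤ lipWeakSup x y e z :=
  Real.iSup_nonneg fun _ => norm_nonneg _

theorem LipLIntBound.mono {T : X × E → F} {C D : ℝ} (h : C ≤ D) (hT : LipLIntBound 𝕜 T C) :
    LipLIntBound 𝕜 T D := fun n x y e z =>
  (hT n x y e z).trans (mul_le_mul_of_nonneg_right h (lipWeakSup_nonneg x y e z))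

theorem LipLIntBound.zero : LipLIntBound 𝕜 (0 : X × E → F) 0 := fun n x y e z => by simp

theorem LipLIntBound.add {S T : X × E → F} {C D : ℝ} (hS : LipLIntBound 𝕜 S C)
    (hT : LipLIntBound 𝕜 T D) : LipLIntBound 𝕜 (S + T) (C + D) := fun n x y e z => by
  have : ∑ i, z i ((S + T) (x i, e i) - (S + T) (y i, e i)) =
      ∑ i, z i (S (x i, e i) - S (y i, e i)) + ∑ i, z i (T (x i, e i) - T (y i, e i)) := by
    rw [← Finset.sum_add_distrib]
    refine Finset.sum_congr rfl fun i _ => ?_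
    rw [← map_add]; congr 1; simp only [Pi.add_apply]; abel
  rw [this, add_mul]
  exact (norm_add_le _ _).trans (add_le_add (hS n x y e z) (hT n x y e z))

theorem LipLIntBound.smul (c : 𝕜) {T : X × E → F} {C : ℝ} (hT : LipLIntBound 𝕜 T C) :
    LipLIntBound 𝕜 (c • T) (‖c‖ * C) := fun n x y e z => by
  have : ∑ i, z i ((c • T) (x i, e i) - (c • T) (y i, e i)) =
      c * ∑ i, z i (T (x i, e i) - T (y i, e i)) := by
    rw [Finset.mul_sum]
    refine Finset.sum_congr rfl fun i _ => ?_
    rw [Pi.smul_apply, Pi.smul_apply, ← smul_sub, map_smul, smul_eq_mul]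
  rw [this, norm_mul, mul_assoc]
  exact mul_le_mul_of_nonneg_left (hT n x y e z) (norm_nonneg c)

theorem lipWeakSup_one_le (x y : X) (e : E) (z : StrongDual 𝕜 F) :
    lipWeakSup (fun _ : Fin 1 => x) (fun _ => y) (fun _ => e) (fun _ => z) ≤
      dist x y * ‖e‖ * ‖z‖ := by
  refine Real.iSup_le (fun p => ?_) (by positivity)
  rw [Fin.sum_univ_one, norm_smul, norm_mul]
  have h1 : ‖p.1.1 x - p.1.1 y‖ ≤ dist x y :=
    (p.1.1.norm_sub_le x y).trans (mul_le_of_le_one_left dist_nonneg p.1.2)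
  have h2 : ‖p.2.1 e‖ ≤ ‖e‖ := by
    have := p.2.1.le_opNorm e
    rwa [p.2.2, one_mul] at this
  gcongr

theorem LipLIntBound.eq_zero {T : X × E → F} (h0 : ∀ e, T (0, e) = 0)
    (h : ∀ C : ℝ, 0 < C → LipLIntBound 𝕜 T C) : T = 0 := by
  funext ⟨x, e⟩
  refine SeparatingDual.eq_zero_of_forall_dual_eq_zero (R := 𝕜) fun z => ?_
  refine norm_le_zero_iff.mp (le_of_forall_pos_le_add fun ε hε => ?_)
  set M := dist x 0 * ‖e‖ * ‖z‖ with hM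
  have hM0 : 0 ≤ M := by positivity
  have := h (ε / (M + 1)) (by positivity) 1 (fun _ => x) (fun _ => 0) (fun _ => e) (fun _ => z)
  rw [Fin.sum_univ_one, h0, sub_zero] at this
  refine this.trans ?_
  have h2 : ε / (M + 1) * lipWeakSup (fun _ : Fin 1 => x) (fun _ => 0) (fun _ => e) (fun _ => z)
      ≤ ε / (M + 1) * M := mul_le_mul_of_nonneg_left (lipWeakSup_one_le x 0 e z) (by positivity)
  refine h2.trans ?_
  rw [zero_add, div_mul_eq_mul_div, div_le_iff₀ (by positivity)]
  nlinarith

variable (𝕜 X E F)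

/-- The integral operators, as a linear subspace of `LipL₀(X × E; F)`. -/
def lipLIntSubmodule : Submodule 𝕜 (LipLZero 𝕜 X E F) where
  carrier := {T | IsLipLIntegral 𝕜 T.1}
  zero_mem' := ⟨1, one_pos, LipLIntBound.zero.mono zero_le_one⟩
  add_mem' := by
    rintro S T ⟨C, hC, hS⟩ ⟨D, hD, hT⟩
    exact ⟨C + D, by positivity, hS.add hT⟩
  smul_mem' := by
    rintro c T ⟨C, hC, hT⟩
    refine ⟨(‖c‖ + 1) * C, by positivity, (hT.smul c).mono ?_⟩
    exact mul_le_mul_of_nonneg_right (by linarith) hC.le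

/-- The space `LipL₀^int(X × E; F)`, normed by `𝔍_int^{LipL}`. -/
def LipLInt : Type _ := lipLIntSubmodule 𝕜 X E F

instance : AddCommGroup (LipLInt 𝕜 X E F) :=
  inferInstanceAs (AddCommGroup (lipLIntSubmodule 𝕜 X E F))
instance : Module 𝕜 (LipLInt 𝕜 X E F) := inferInstanceAs (Module 𝕜 (lipLIntSubmodule 𝕜 X E F))

variable {𝕜 X E F}

/-- The underlying element of `LipL₀(X × E; F)`. -/
def LipLInt.toLipLZero (T : LipLInt 𝕜 X E F) : LipLZero 𝕜 X E F := T.1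

instance : Norm (LipLInt 𝕜 X E F) := ⟨fun T => lipLIntNorm 𝕜 T.toLipLZero.1⟩

theorem LipLInt.core : NormedSpace.Core 𝕜 (LipLInt 𝕜 X E F) :=
  core_sInf (fun T C => LipLIntBound 𝕜 T.toLipLZero.1 C) (fun _ => rfl) (fun T => T.2)
    (fun _ _ _ _ hS hT => hS.add hT) (fun c _ _ hT => hT.smul c)
    (fun _ _ _ h hT => hT.mono h)
    (fun T h => Subtype.ext (Subtype.ext (LipLIntBound.eq_zero T.toLipLZero.2.2 h)))

instance : NormedAddCommGroup (LipLInt 𝕜 X E F) := NormedAddCommGroup.ofCore LipLInt.core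
instance : NormedSpace 𝕜 (LipLInt 𝕜 X E F) := NormedSpace.ofCore LipLInt.core

end LipLinear

/-! ## Integral bilinear operators -/

section Bilinear

variable (𝕜 E F G : Type*) [RCLike 𝕜]
  [NormedAddCommGroup E] [NormedSpace 𝕜 E] [NormedAddCommGroup F] [NormedSpace 𝕜 F]
  [NormedAddCommGroup G] [NormedSpace 𝕜 G]

variable {𝕜 E F G}

/-- `sup ‖∑ᵢ x*(xᵢ) y*(yᵢ) zᵢ*‖` over `x* ∈ B_{E*}` and `y* ∈ B_{F*}`. -/
def bilWeakSup {n : ℕ} (x : Fin n → E) (y : Fin n → F) (z : Fin n → StrongDual 𝕜 G) : ℝ :=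
  ⨆ p : {φ : StrongDual 𝕜 E // ‖φ‖ ≤ 1} × {ψ : StrongDual 𝕜 F // ‖ψ‖ ≤ 1},
    ‖∑ i, (p.1.1 (x i) * p.2.1 (y i)) • z i‖

/-- `C` satisfies the inequality that defines integrality of `B : E × F → G`. -/
def BilIntBound (B : E →L[𝕜] F →L[𝕜] G) (C : ℝ) : Prop :=
  ∀ (n : ℕ) (x : Fin n → E) (y : Fin n → F) (z : Fin n → StrongDual 𝕜 G),
    ‖∑ i, z i (B (x i) (y i))‖ ≤ C * bilWeakSup x y z

/-- Integrality of a bilinear operator. -/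
def IsBilIntegral (B : E →L[𝕜] F →L[𝕜] G) : Prop := ∃ C : ℝ, 0 < C ∧ BilIntBound B C

/-- `𝔍_int^2(B)`. -/
def bilIntNorm (B : E →L[𝕜] F →L[𝕜] G) : ℝ := sInf {C : ℝ | 0 < C ∧ BilIntBound B C}

theorem bilWeakSup_nonneg {n : ℕ} (x : Fin n → E) (y : Fin n → F)
    (z : Fin n → StrongDual 𝕜 G) : 0 ≤ bilWeakSup x y z :=
  Real.iSup_nonneg fun _ => norm_nonneg _

theorem BilIntBound.mono {B : E →L[𝕜] F →L[𝕜] G} {C D : ℝ} (h : C ≤ D) (hB : BilIntBound B C) :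
    BilIntBound B D := fun n x y z =>
  (hB n x y z).trans (mul_le_mul_of_nonneg_right h (bilWeakSup_nonneg x y z))

theorem BilIntBound.zero : BilIntBound (0 : E →L[𝕜] F →L[𝕜] G) 0 := fun n x y z => by simp

theorem BilIntBound.add {A B : E →L[𝕜] F →L[𝕜] G} {C D : ℝ} (hA : BilIntBound A C)
    (hB : BilIntBound B D) : BilIntBound (A + B) (C + D) := fun n x y z => by
  have : ∑ i, z i ((A + B) (x i) (y i)) =
      ∑ i, z i (A (x i) (y i)) + ∑ i, z i (B (x i) (y i)) := by
    simp [Finset.sum_add_distrib]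
  rw [this, add_mul]
  exact (norm_add_le _ _).trans (add_le_add (hA n x y z) (hB n x y z))

theorem BilIntBound.smul (c : 𝕜) {B : E →L[𝕜] F →L[𝕜] G} {C : ℝ} (hB : BilIntBound B C) :
    BilIntBound (c • B) (‖c‖ * C) := fun n x y z => by
  have : ∑ i, z i ((c • B) (x i) (y i)) = c * ∑ i, z i (B (x i) (y i)) := by
    simp [Finset.mul_sum]
  rw [this, norm_mul, mul_assoc]
  exact mul_le_mul_of_nonneg_left (hB n x y z) (norm_nonneg c)

theorem bilWeakSup_one_le (x : E) (y : F) (z : StrongDual 𝕜 G) :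
    bilWeakSup (fun _ : Fin 1 => x) (fun _ => y) (fun _ => z) ≤ ‖x‖ * ‖y‖ * ‖z‖ := by
  refine Real.iSup_le (fun p => ?_) (by positivity)
  rw [Fin.sum_univ_one, norm_smul, norm_mul]
  have h1 : ‖p.1.1 x‖ ≤ ‖x‖ :=
    (p.1.1.le_opNorm x).trans (mul_le_of_le_one_left (norm_nonneg x) p.1.2)
  have h2 : ‖p.2.1 y‖ ≤ ‖y‖ :=
    (p.2.1.le_opNorm y).trans (mul_le_of_le_one_left (norm_nonneg y) p.2.2)
  gcongr

theorem BilIntBound.eq_zero {B : E →L[𝕜] F →L[𝕜] G}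
    (h : ∀ C : ℝ, 0 < C → BilIntBound B C) : B = 0 := by
  ext x y
  refine SeparatingDual.eq_zero_of_forall_dual_eq_zero (R := 𝕜) fun z => ?_
  refine norm_le_zero_iff.mp (le_of_forall_pos_le_add fun ε hε => ?_)
  set M := ‖x‖ * ‖y‖ * ‖z‖ with hM
  have hM0 : 0 ≤ M := by positivity
  have := h (ε / (M + 1)) (by positivity) 1 (fun _ => x) (fun _ => y) (fun _ => z)
  rw [Fin.sum_univ_one] at this
  refine this.trans ?_
  have h2 : ε / (M + 1) * bilWeakSup (fun _ : Fin 1 => x) (fun _ => y) (fun _ => z)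
      ≤ ε / (M + 1) * M := mul_le_mul_of_nonneg_left (bilWeakSup_one_le x y z) (by positivity)
  refine h2.trans ?_
  rw [zero_add, div_mul_eq_mul_div, div_le_iff₀ (by positivity)]
  nlinarith

variable (𝕜 E F G)

/-- The integral operators, as a linear subspace of the continuous bilinear operators. -/
def bilIntSubmodule : Submodule 𝕜 (E →L[𝕜] F →L[𝕜] G) where
  carrier := {B | IsBilIntegral B}
  zero_mem' := ⟨1, one_pos, BilIntBound.zero.mono zero_le_one⟩
  add_mem' := by
    rintro A B ⟨C, hC, hA⟩ ⟨D, hD, hB⟩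
    exact ⟨C + D, by positivity, hA.add hB⟩
  smul_mem' := by
    rintro c B ⟨C, hC, hB⟩
    refine ⟨(‖c‖ + 1) * C, by positivity, (hB.smul c).mono ?_⟩
    exact mul_le_mul_of_nonneg_right (by linarith) hC.le

/-- The space `BI(E × F; G)`, normed by `𝔍_int^2`. -/
def BilInt : Type _ := bilIntSubmodule 𝕜 E F G

instance : AddCommGroup (BilInt 𝕜 E F G) := inferInstanceAs (AddCommGroup (bilIntSubmodule 𝕜 E F G))
instance : Module 𝕜 (BilInt 𝕜 E F G) := inferInstanceAs (Module 𝕜 (bilIntSubmodule 𝕜 E F G))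

variable {𝕜 E F G}

/-- The underlying continuous bilinear operator. -/
def BilInt.toBilinear (B : BilInt 𝕜 E F G) : E →L[𝕜] F →L[𝕜] G := B.1

instance : Norm (BilInt 𝕜 E F G) := ⟨fun B => bilIntNorm B.toBilinear⟩

theorem BilInt.core : NormedSpace.Core 𝕜 (BilInt 𝕜 E F G) :=
  core_sInf (fun B C => BilIntBound B.toBilinear C) (fun _ => rfl) (fun B => B.2)
    (fun _ _ _ _ hS hT => hS.add hT) (fun c _ _ hT => hT.smul c)
    (fun _ _ _ h hT => hT.mono h)
    (fun _ h => Subtype.ext (BilIntBound.eq_zero h))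

instance : NormedAddCommGroup (BilInt 𝕜 E F G) := NormedAddCommGroup.ofCore BilInt.core
instance : NormedSpace 𝕜 (BilInt 𝕜 E F G) := NormedSpace.ofCore BilInt.core

end Bilinear

/-! ## The Lipschitz injective tensor product -/

section Tensor

variable (𝕜 X E : Type*) [RCLike 𝕜] [MetricSpace X] [Zero X]
  [NormedAddCommGroup E] [NormedSpace 𝕜 E]

variable {X E} in
/-- The functional `δ_{(x,y)} ⊠ e` on `Lip₀(X; E*)`, `g ↦ ⟨g(x) - g(y), e⟩`. -/
def boxFunctional (x y : X) (e : E) : Module.Dual 𝕜 (LipZero 𝕜 X (StrongDual 𝕜 E)) where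
  toFun g := (g x - g y) e
  map_add' f g := by
    simp only [LipZero.add_apply, sub_apply, add_apply]; ring
  map_smul' c g := by
    simp only [LipZero.smul_apply, ← smul_sub, smul_apply, RingHom.id_apply]

/-- The linear span of the functionals `δ_{(x,y)} ⊠ e`. -/
def lipTensorSubmodule : Submodule 𝕜 (Module.Dual 𝕜 (LipZero 𝕜 X (StrongDual 𝕜 E))) :=
  Submodule.span 𝕜 (Set.range fun p : X × X × E => boxFunctional 𝕜 p.1 p.2.1 p.2.2)

/-- The Lipschitz tensor product `X ⊠ E`; below it is normed by the Lipschitz injective norm. -/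
def LipTensor : Type _ := lipTensorSubmodule 𝕜 X E

instance : AddCommGroup (LipTensor 𝕜 X E) :=
  inferInstanceAs (AddCommGroup (lipTensorSubmodule 𝕜 X E))
instance : Module 𝕜 (LipTensor 𝕜 X E) := inferInstanceAs (Module 𝕜 (lipTensorSubmodule 𝕜 X E))

variable {𝕜 X E}

variable (𝕜) in
/-- `δ_{(x,y)} ⊠ e` as an element of `X ⊠ E`. -/
def box (x y : X) (e : E) : LipTensor 𝕜 X E :=
  ⟨boxFunctional 𝕜 x y e, Submodule.subset_span ⟨(x, y, e), rfl⟩⟩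

/-- The underlying functional on `Lip₀(X; E*)`. -/
def LipTensor.toDual : LipTensor 𝕜 X E →ₗ[𝕜] Module.Dual 𝕜 (LipZero 𝕜 X (StrongDual 𝕜 E)) :=
  (lipTensorSubmodule 𝕜 X E).subtype

/-- The element `x ↦ f(x) e*` of `Lip₀(X; E*)`. -/
def elem (f : LipZero 𝕜 X 𝕜) (φ : StrongDual 𝕜 E) : LipZero 𝕜 X (StrongDual 𝕜 E) :=
  LipZero.mk (fun x => f x • φ)
    ((congrArg (· • φ) f.map_zero).trans (zero_smul 𝕜 φ)) (‖f‖ * ‖φ‖) (fun x y => by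
      rw [← (sub_smul (f x) (f y) φ : _ = f x • φ - f y • φ)]
      refine (norm_smul (f x - f y) φ).le.trans ?_
      rw [mul_right_comm]
      exact mul_le_mul_of_nonneg_right (f.norm_sub_le x y) (norm_nonneg φ))

theorem toDual_box_elem (x y : X) (e : E) (f : LipZero 𝕜 X 𝕜) (φ : StrongDual 𝕜 E) :
    (box 𝕜 x y e).toDual (elem f φ) = (f x - f y) * φ e := by
  change f x * φ e - f y * φ e = _
  ring

/-- The Lipschitz injective norm: for `u = ∑ᵢ δ_{(xᵢ,yᵢ)} ⊠ eᵢ` the number `u (f · e*)` equals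
`∑ᵢ (f(xᵢ) - f(yᵢ)) e*(eᵢ)`, see `LipTensor.norm_sum_box`. -/
instance : Norm (LipTensor 𝕜 X E) :=
  ⟨fun u => ⨆ p : {f : LipZero 𝕜 X 𝕜 // ‖f‖ ≤ 1} × {φ : StrongDual 𝕜 E // ‖φ‖ = 1},
    ‖u.toDual (elem p.1.1 p.2.1)‖⟩

theorem LipTensor.norm_def (u : LipTensor 𝕜 X E) :
    ‖u‖ = ⨆ p : {f : LipZero 𝕜 X 𝕜 // ‖f‖ ≤ 1} × {φ : StrongDual 𝕜 E // ‖φ‖ = 1},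
      ‖u.toDual (elem p.1.1 p.2.1)‖ := rfl

theorem LipTensor.norm_sum_box {n : ℕ} (x y : Fin n → X) (e : Fin n → E) :
    ‖∑ i, box 𝕜 (x i) (y i) (e i)‖ =
      ⨆ p : {f : LipZero 𝕜 X 𝕜 // ‖f‖ ≤ 1} × {φ : StrongDual 𝕜 E // ‖φ‖ = 1},
        ‖∑ i, (p.1.1 (x i) - p.1.1 (y i)) * p.2.1 (e i)‖ := by
  rw [LipTensor.norm_def]
  congr 1; ext p
  rw [map_sum, LinearMap.sum_apply]
  simp only [toDual_box_elem]

theorem LipTensor.exists_rep (u : LipTensor 𝕜 X E) :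
    ∃ (n : ℕ) (x y : Fin n → X) (e : Fin n → E), u = ∑ i, box 𝕜 (x i) (y i) (e i) := by
  have key : ∀ v ∈ lipTensorSubmodule 𝕜 X E,
      ∃ (n : ℕ) (x y : Fin n → X) (e : Fin n → E),
        v = ∑ i, boxFunctional 𝕜 (x i) (y i) (e i) := by
    intro v hv
    induction hv using Submodule.span_induction with
    | mem v h =>
      obtain ⟨⟨x, y, e⟩, rfl⟩ := h
      exact ⟨1, fun _ => x, fun _ => y, fun _ => e, by simp⟩
    | zero => exact ⟨0, Fin.elim0, Fin.elim0, Fin.elim0, by simp⟩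
    | add v w _ _ hv hw =>
      obtain ⟨n, x, y, e, rfl⟩ := hv
      obtain ⟨m, x', y', e', rfl⟩ := hw
      exact ⟨n + m, Fin.append x x', Fin.append y y', Fin.append e e', by
        simp [Fin.sum_univ_add]⟩
    | smul c v _ hv =>
      obtain ⟨n, x, y, e, rfl⟩ := hv
      refine ⟨n, x, y, fun i => c • e i, ?_⟩
      rw [Finset.smul_sum]
      refine Finset.sum_congr rfl fun i _ => LinearMap.ext fun g => ?_
      exact (map_smul (g (x i) - g (y i)) c (e i)).symm
  obtain ⟨n, x, y, e, h⟩ := key u.1 u.2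
  refine ⟨n, x, y, e, Subtype.ext (h.trans ?_)⟩
  change _ = LipTensor.toDual (∑ i, box 𝕜 (x i) (y i) (e i))
  rw [map_sum]; rfl

theorem LipTensor.bdd (u : LipTensor 𝕜 X E) :
    BddAbove (Set.range fun p : {f : LipZero 𝕜 X 𝕜 // ‖f‖ ≤ 1} × {φ : StrongDual 𝕜 E // ‖φ‖ = 1} =>
      ‖u.toDual (elem p.1.1 p.2.1)‖) := by
  obtain ⟨n, x, y, e, rfl⟩ := u.exists_rep
  refine ⟨∑ i, dist (x i) (y i) * ‖e i‖, ?_⟩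
  rintro _ ⟨p, rfl⟩
  simp only [map_sum, LinearMap.sum_apply, toDual_box_elem]
  refine (norm_sum_le _ _).trans (Finset.sum_le_sum fun i _ => ?_)
  rw [norm_mul]
  have h1 : ‖p.1.1 (x i) - p.1.1 (y i)‖ ≤ dist (x i) (y i) :=
    (p.1.1.norm_sub_le _ _).trans (mul_le_of_le_one_left dist_nonneg p.1.2)
  have h2 : ‖p.2.1 (e i)‖ ≤ ‖e i‖ := by
    have := p.2.1.le_opNorm (e i)
    rwa [p.2.2, one_mul] at this
  gcongr

theorem elem_smul (c d : 𝕜) (f : LipZero 𝕜 X 𝕜) (φ : StrongDual 𝕜 E) :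
    elem (c • f) (d • φ) = (c * d) • elem f φ := by
  refine LipZero.ext fun x => ?_
  change (c * f x) • d • φ = (c * d) • f x • φ
  rw [smul_smul, smul_smul, mul_right_comm]

theorem LipTensor.elem_eq_zero {u : LipTensor 𝕜 X E} (hu : ‖u‖ = 0)
    (f : LipZero 𝕜 X 𝕜) (φ : StrongDual 𝕜 E) : u.toDual (elem f φ) = 0 := by
  by_cases hf : f = 0
  · subst hf
    have : elem (0 : LipZero 𝕜 X 𝕜) φ = 0 := LipZero.ext fun x => zero_smul 𝕜 φ
    rw [this, map_zero]
  by_cases hφ : φ = 0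
  · subst hφ
    have : elem f (0 : StrongDual 𝕜 E) = 0 := LipZero.ext fun x => smul_zero (A := StrongDual 𝕜 E) (f x)
    rw [this, map_zero]
  have hf' : (‖f‖ : 𝕜) ≠ 0 := by simpa using hf
  have hφ' : (‖φ‖ : 𝕜) ≠ 0 := by simpa using hφ
  have h := le_ciSup u.bdd (⟨(‖f‖ : 𝕜)⁻¹ • f, (norm_smul_inv_norm hf).le⟩,
    ⟨(‖φ‖ : 𝕜)⁻¹ • φ, norm_smul_inv_norm hφ⟩)
  rw [← LipTensor.norm_def, hu] at h
  have h' := norm_le_zero_iff.mp h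
  simp only [elem_smul, map_smul, smul_eq_mul] at h'
  exact (mul_eq_zero.mp h').resolve_left (mul_ne_zero (inv_ne_zero hf') (inv_ne_zero hφ'))

theorem LipTensor.eq_zero {u : LipTensor 𝕜 X E} (hu : ‖u‖ = 0) : u = 0 := by
  obtain ⟨n, x, y, e, hrep⟩ := u.exists_rep
  let S : Submodule 𝕜 E := Submodule.span 𝕜 (Set.range e)
  have : FiniteDimensional 𝕜 S := FiniteDimensional.span_of_finite 𝕜 (Set.finite_range e)
  let b := Module.finBasis 𝕜 S
  have hmem : ∀ i, e i ∈ S := fun i => Submodule.subset_span ⟨i, rfl⟩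
  choose ψ hψ using fun k => exists_extension_norm_eq S (LinearMap.toContinuousLinearMap (b.coord k))
  have hψ' : ∀ k (s : S), ψ k s = b.repr s k := fun k s => (hψ k).1 s
  refine Subtype.ext (LinearMap.ext fun g => ?_)
  let gk : Fin (Module.finrank 𝕜 S) → LipZero 𝕜 X 𝕜 := fun k =>
    LipZero.mk (fun t => g t (b k)) (by simp) (‖g‖ * ‖(b k : E)‖) (fun s t => by
      rw [mul_right_comm]
      exact ((g s - g t).le_opNorm _).trans
        (mul_le_mul_of_nonneg_right (g.norm_sub_le s t) (norm_nonneg _)))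
  have hsum : u.toDual g = ∑ k, u.toDual (elem (gk k) (ψ k)) := by
    rw [hrep]
    simp only [map_sum, LinearMap.sum_apply, toDual_box_elem]
    rw [Finset.sum_comm]
    refine Finset.sum_congr rfl fun i _ => ?_
    have he : e i = ∑ k, ψ k (e i) • (b k : E) := by
      have := congrArg (Subtype.val) (b.sum_repr ⟨e i, hmem i⟩)
      rw [Submodule.coe_sum] at this
      refine this.symm.trans (Finset.sum_congr rfl fun k _ => ?_)
      rw [show ψ k (e i) = b.repr ⟨e i, hmem i⟩ k from hψ' k ⟨e i, hmem i⟩]; rfl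
    change (g (x i) - g (y i)) (e i) = _
    conv_lhs => rw [he]
    rw [map_sum]
    refine Finset.sum_congr rfl fun k _ => ?_
    rw [map_smul, smul_eq_mul, mul_comm]; rfl
  change u.toDual g = 0
  rw [hsum]
  exact Finset.sum_eq_zero fun k _ => LipTensor.elem_eq_zero hu _ _

theorem LipTensor.core : NormedSpace.Core 𝕜 (LipTensor 𝕜 X E) where
  norm_nonneg u := Real.iSup_nonneg fun _ => norm_nonneg _
  norm_smul c u := by
    rw [LipTensor.norm_def, LipTensor.norm_def, Real.mul_iSup_of_nonneg (norm_nonneg c)]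
    congr 1; ext p
    rw [map_smul, LinearMap.smul_apply, norm_smul]
  norm_triangle u v := by
    refine Real.iSup_le (fun p => ?_) (add_nonneg (Real.iSup_nonneg fun _ => norm_nonneg _)
      (Real.iSup_nonneg fun _ => norm_nonneg _))
    rw [map_add, LinearMap.add_apply]
    exact (norm_add_le _ _).trans (add_le_add (le_ciSup u.bdd p) (le_ciSup v.bdd p))
  norm_eq_zero_iff u := ⟨LipTensor.eq_zero, fun h => by
    subst h
    rw [LipTensor.norm_def]
    simp⟩

instance : NormedAddCommGroup (LipTensor 𝕜 X E) := NormedAddCommGroup.ofCore LipTensor.core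
instance : NormedSpace 𝕜 (LipTensor 𝕜 X E) := NormedSpace.ofCore LipTensor.core

variable (𝕜 X E) in
/-- `X ⊠̂_ε E`: the completion of `X ⊠ E` for the Lipschitz injective norm. -/
abbrev InjLipTensor : Type _ := UniformSpace.Completion (LipTensor 𝕜 X E)

end Tensor

end LipLin

end

namespace LipLin

/-! Two isometries carry the theorem. First, the weak supremum attached to `xᵢ, yᵢ, eᵢ, zᵢ*` is the
operator norm of `∑ᵢ (δ_{xᵢ} - δ_{yᵢ}) ⊗ eᵢ ⊗ zᵢ*`, regarded as a bilinear map on `𝓕(X)* × E*`,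
because `X^#` is the dual of `𝓕(X)`. Hence a constant is admissible for `T` as soon as it is
admissible for `T_bil`. Conversely, scalars in a combination of the `δ_x` can be moved to the second
factor, so a constant admissible for `T` is admissible for `T_bil` on the span of the `δ_x` in the
first variable; both sides of the inequality are continuous, and the span is dense.

Second, for `F = 𝕜` the weak supremum is the Lipschitz injective norm of
`∑ᵢ δ_{(xᵢ,yᵢ)} ⊠ zᵢ*(1) eᵢ`, so a constant is admissible for `T` exactly when it bounds the
functional on `X ⊠ E` that `T` induces. -/

set_option maxSynthPendingDepth 3

open ContinuousLinearMap Set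

section General

theorem csInf_Ioi_inter_Ici {α : Type*} [ConditionallyCompleteLinearOrder α] [DenselyOrdered α]
    [NoMaxOrder α] {a b : α} (h : b ≤ a) : sInf (Ioi b ∩ Ici a) = a := by
  rcases h.eq_or_lt with rfl | hlt
  · rw [inter_eq_left.2 Ioi_subset_Ici_self, csInf_Ioi]
  · rw [inter_eq_right.2 (Ici_subset_Ioi.2 hlt), csInf_Ici]

theorem sum_equivFin_symm {ι M : Type*} [AddCommMonoid M] (s : Finset ι) (f : ι → M) :
    ∑ k, f (s.equivFin.symm k) = ∑ i ∈ s, f i := by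
  rw [s.equivFin.symm.sum_comp fun i => f i, s.sum_coe_sort]

theorem iSup_norm_apply₂_eq_opNorm {𝕜 E F G : Type*} [RCLike 𝕜] [NormedAddCommGroup E]
    [NormedSpace 𝕜 E] [NormedAddCommGroup F] [NormedSpace 𝕜 F] [NormedAddCommGroup G]
    [NormedSpace 𝕜 G] (S : E →L[𝕜] F →L[𝕜] G) {p : E → Prop} {q : F → Prop}
    (p_ball : ∀ x, p x → ‖x‖ ≤ 1) (p_sphere : ∀ x, ‖x‖ = 1 → p x)
    (q_ball : ∀ y, q y → ‖y‖ ≤ 1) (q_sphere : ∀ y, ‖y‖ = 1 → q y) :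
    ⨆ v : {x // p x} × {y // q y}, ‖S v.1 v.2‖ = ‖S‖ := by
  have le_norm (v : {x // p x} × {y // q y}) : ‖S v.1 v.2‖ ≤ ‖S‖ := by
    simpa using S.le_of_opNorm₂_le_of_le le_rfl (p_ball _ v.1.2) (q_ball _ v.2.2)
  have sup_nonneg : 0 ≤ ⨆ v : {x // p x} × {y // q y}, ‖S v.1 v.2‖ :=
    Real.iSup_nonneg fun _ => norm_nonneg _
  refine le_antisymm (Real.iSup_le le_norm (norm_nonneg S)) ?_
  refine opNorm_le_of_unit_norm sup_nonneg fun x hx =>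
    opNorm_le_of_unit_norm sup_nonneg fun y hy => ?_
  exact le_ciSup (f := fun v : {x // p x} × {y // q y} => ‖S v.1 v.2‖)
    ⟨‖S‖, forall_mem_range.2 le_norm⟩ (⟨x, p_sphere x hx⟩, ⟨y, q_sphere y hy⟩)

variable (𝕜 V W : Type*) [NontriviallyNormedField 𝕜] [NormedAddCommGroup V] [NormedSpace 𝕜 V]
  [NormedAddCommGroup W] [NormedSpace 𝕜 W] [CompleteSpace W]

open UniformSpace in
/-- Restriction to `V`, as an isometry from the operators on the completion of `V` onto the
operators on `V`. -/
noncomputable def completionRestrictEquiv : (Completion V →L[𝕜] W) ≃ₗᵢ[𝕜] (V →L[𝕜] W) where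
  toFun A := A ∘L Completion.toComplL
  invFun A := A.extend Completion.toComplL
  map_add' _ _ := rfl
  map_smul' _ _ := rfl
  left_inv A := extend_unique _ Completion.denseRange_coe (Completion.isUniformInducing_coe V) A rfl
  right_inv A := ContinuousLinearMap.ext
    (A.extend_eq Completion.denseRange_coe (Completion.isUniformInducing_coe V))
  norm_map' A := by
    refine le_antisymm (opNorm_le_bound _ (norm_nonneg A) fun v => ?_)
      (opNorm_le_bound _ (norm_nonneg _) fun v => ?_)
    · exact (A.le_opNorm v).trans_eq (by rw [Completion.norm_coe])
    · refine Completion.induction_on v (isClosed_le (by fun_prop) (by fun_prop)) fun a => ?_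
      rw [Completion.norm_coe]
      exact (A ∘L Completion.toComplL).le_opNorm a

end General

section ElementaryTensor

variable {𝕜 E F H : Type*} [NontriviallyNormedField 𝕜] [NormedAddCommGroup E] [NormedSpace 𝕜 E]
  [NormedAddCommGroup F] [NormedSpace 𝕜 F] [NormedAddCommGroup H] [NormedSpace 𝕜 H]

variable (𝕜) in
/-- `x ↦ x ⊗ y ⊗ z`, where `x ⊗ y ⊗ z` is regarded as the bilinear map `(φ, ψ) ↦ φ(x) ψ(y) z` on
`E* × F*`. -/
noncomputable def elementaryTensor (y : F) (z : H) :
    E →L[𝕜] StrongDual 𝕜 E →L[𝕜] StrongDual 𝕜 F →L[𝕜] H :=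
  (smulRightL 𝕜 (StrongDual 𝕜 E) (StrongDual 𝕜 F →L[𝕜] H)).flip
    ((NormedSpace.inclusionInDoubleDual 𝕜 F y).smulRight z) ∘L
      NormedSpace.inclusionInDoubleDual 𝕜 E

theorem elementaryTensor_apply (x : E) (y : F) (z : H) (φ : StrongDual 𝕜 E)
    (ψ : StrongDual 𝕜 F) : elementaryTensor 𝕜 y z x φ ψ = (φ x * ψ y) • z :=
  (mul_smul (φ x) (ψ y) z).symm

theorem elementaryTensor_smul (c : 𝕜) (x : E) (y : F) (z : H) :
    elementaryTensor 𝕜 (c • y) z x = c • elementaryTensor 𝕜 y z x := by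
  ext φ ψ
  simp only [elementaryTensor_apply, smul_apply, map_smul, smul_eq_mul, smul_smul, mul_left_comm]

end ElementaryTensor

section FreeSpace

variable {𝕜 X G : Type*} [RCLike 𝕜] [MetricSpace X] [Zero X]
  [NormedAddCommGroup G] [NormedSpace 𝕜 G]

theorem delta_zero : delta 𝕜 (0 : X) = 0 :=
  Subtype.ext (ContinuousLinearMap.ext fun f => f.map_zero)

theorem norm_delta_sub_le (x y : X) : ‖delta 𝕜 x - delta 𝕜 y‖ ≤ dist x y :=
  opNorm_le_bound (evalDual 𝕜 x - evalDual 𝕜 y) dist_nonneg fun f =>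
    (f.norm_sub_le x y).trans_eq (mul_comm _ _)

theorem norm_apply_delta_sub_le (A : LipFree 𝕜 X →L[𝕜] G) (x y : X) :
    ‖A (delta 𝕜 x) - A (delta 𝕜 y)‖ ≤ ‖A‖ * dist x y := by
  rw [← map_sub]
  exact A.le_opNorm_of_le (norm_delta_sub_le x y)

/-- The Lipschitz function `x ↦ A(δ_x)`; `A ↦ compDelta A` is inverse to `linearize`. -/
noncomputable def compDelta (A : LipFree 𝕜 X →L[𝕜] G) : LipZero 𝕜 X G :=
  LipZero.mk (fun x => A (delta 𝕜 x)) (by rw [delta_zero, map_zero]) ‖A‖ (norm_apply_delta_sub_le A)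

variable (𝕜 X G) in
/-- The universal property of `𝓕(X)`: `R ↦ R_L` is an isometry of `Lip₀(X; G)` onto
`𝓛(𝓕(X); G)`. -/
noncomputable def linearizeEquiv [CompleteSpace G] :
    LipZero 𝕜 X G ≃ₗᵢ[𝕜] (LipFree 𝕜 X →L[𝕜] G) where
  toFun := linearize
  invFun := compDelta
  map_add' R S := freeSpace_ext fun x => by
    simp only [linearize_delta, add_apply, LipZero.add_apply]
  map_smul' c R := freeSpace_ext fun x => by
    simp only [linearize_delta, smul_apply, LipZero.smul_apply, RingHom.id_apply]
  left_inv R := LipZero.ext fun x => linearize_delta R x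
  right_inv A := freeSpace_ext fun x => linearize_delta (compDelta A) x
  norm_map' R := by
    change ‖linearize R‖ = ‖R‖
    refine le_antisymm (LinearMap.mkContinuous_norm_le _ (norm_nonneg R) _)
      (R.norm_le (norm_nonneg _) fun x y => ?_)
    simpa only [linearize_delta] using norm_apply_delta_sub_le (linearize R) x y

theorem linearizeEquiv_apply_delta [CompleteSpace G] (R : LipZero 𝕜 X G) (x : X) :
    linearizeEquiv 𝕜 X G R (delta 𝕜 x) = R x :=
  linearize_delta R x

theorem denseRange_linearCombination_delta :
    DenseRange (Finsupp.linearCombination 𝕜 (delta 𝕜 (X := X))) := by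
  refine Subtype.dense_iff.2 (closure_mono fun m hm => ?_)
  obtain ⟨a, rfl⟩ := (Finsupp.mem_span_range_iff_exists_finsupp (R := 𝕜)).1 hm
  exact ⟨_, mem_range_self a, map_finsuppSum (LipFree.incl 𝕜 X) a _⟩

end FreeSpace

section WeakSup

variable {𝕜 X E F G : Type*} [RCLike 𝕜] [MetricSpace X] [Zero X]
  [NormedAddCommGroup E] [NormedSpace 𝕜 E] [NormedAddCommGroup F] [NormedSpace 𝕜 F]
  [NormedAddCommGroup G] [NormedSpace 𝕜 G]

theorem bilWeakSup_eq_opNorm {n : ℕ} (x : Fin n → E) (y : Fin n → F)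
    (z : Fin n → StrongDual 𝕜 G) :
    bilWeakSup x y z = ‖∑ i, elementaryTensor 𝕜 (y i) (z i) (x i)‖ := by
  rw [← iSup_norm_apply₂_eq_opNorm _ (fun _ => id) (fun _ => Eq.le) (fun _ => id) (fun _ => Eq.le)]
  simp only [bilWeakSup, sum_apply, elementaryTensor_apply]

theorem lipWeakSup_eq_opNorm {n : ℕ} (x y : Fin n → X) (e : Fin n → E)
    (z : Fin n → StrongDual 𝕜 F) :
    lipWeakSup x y e z = ‖∑ i, elementaryTensor 𝕜 (e i) (z i) (delta 𝕜 (x i) - delta 𝕜 (y i))‖ := by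
  rw [← opNorm_comp_linearIsometryEquiv _ (linearizeEquiv 𝕜 X 𝕜),
    ← iSup_norm_apply₂_eq_opNorm _ (fun _ => id) (fun _ => Eq.le) (fun _ => Eq.le) (fun _ => id)]
  simp only [lipWeakSup, coe_comp, Function.comp_apply, ContinuousLinearEquiv.coe_coe,
    LinearIsometryEquiv.coe_toContinuousLinearEquiv, sum_apply, elementaryTensor_apply]
  simp only [map_sub, linearizeEquiv_apply_delta]

end WeakSup

section Correspondence

variable {𝕜 X E F G : Type*} [RCLike 𝕜] [MetricSpace X] [Zero X]
  [NormedAddCommGroup E] [NormedSpace 𝕜 E] [NormedAddCommGroup F] [NormedSpace 𝕜 F]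
  [NormedAddCommGroup G] [NormedSpace 𝕜 G]

theorem BilIntBound.of_denseRange {B : E →L[𝕜] F →L[𝕜] G} {C : ℝ} {ι : Type*} {d : ι → E}
    (hd : DenseRange d)
    (h : ∀ (n : ℕ) (a : Fin n → ι) (y : Fin n → F) (z : Fin n → StrongDual 𝕜 G),
      ‖∑ i, z i (B (d (a i)) (y i))‖ ≤ C * bilWeakSup (fun i => d (a i)) y z) :
    BilIntBound B C := fun n x y z => by
  simp only [bilWeakSup_eq_opNorm] at h ⊢
  exact (DenseRange.piMap fun _ => hd).induction_on x
    (isClosed_le (by fun_prop) (by fun_prop)) fun a => h n a y z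

theorem LipLIntBound.norm_sum_finset_le {T : X × E → F} {C : ℝ} (h : LipLIntBound 𝕜 T C)
    {ι : Type*} (s : Finset ι) (x y : ι → X) (e : ι → E) (z : ι → StrongDual 𝕜 F) :
    ‖∑ i ∈ s, z i (T (x i, e i) - T (y i, e i))‖ ≤
      C * ‖∑ i ∈ s, elementaryTensor 𝕜 (e i) (z i) (delta 𝕜 (x i) - delta 𝕜 (y i))‖ := by
  have key := h s.card (fun k => x (s.equivFin.symm k)) (fun k => y (s.equivFin.symm k))
    (fun k => e (s.equivFin.symm k)) (fun k => z (s.equivFin.symm k))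
  rw [lipWeakSup_eq_opNorm] at key
  rw [← sum_equivFin_symm s, ← sum_equivFin_symm s]
  exact key

theorem elementaryTensor_linearCombination_delta (a : X →₀ 𝕜) (e : E) (z : G) :
    elementaryTensor 𝕜 e z (Finsupp.linearCombination 𝕜 (delta 𝕜) a) =
      ∑ x ∈ a.support, elementaryTensor 𝕜 (a x • e) z (delta 𝕜 x - delta 𝕜 0) := by
  simp only [Finsupp.linearCombination_apply, Finsupp.sum, map_sum, map_smul,
    elementaryTensor_smul, delta_zero, sub_zero]

variable [CompleteSpace F]

theorem Tbil_linearCombination_delta (T : LipLZero 𝕜 X E F) (a : X →₀ 𝕜) (e : E) :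
    Tbil T (Finsupp.linearCombination 𝕜 (delta 𝕜) a) e =
      ∑ x ∈ a.support, (T.1 (x, a x • e) - T.1 (0, a x • e)) := by
  simp only [Finsupp.linearCombination_apply, Finsupp.sum, map_sum, map_smul, sum_apply, smul_apply,
    ← Tbil_delta, delta_zero, map_zero, zero_apply, smul_zero, sub_zero]

theorem BilIntBound.of_lipLIntBound {T : LipLZero 𝕜 X E F} {C : ℝ} (h : LipLIntBound 𝕜 T.1 C) :
    BilIntBound (Tbil T) C := by
  refine .of_denseRange denseRange_linearCombination_delta fun n a e z => ?_
  simp only [bilWeakSup_eq_opNorm, Tbil_linearCombination_delta,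
    elementaryTensor_linearCombination_delta, map_sum, Finset.sum_sigma']
  exact h.norm_sum_finset_le (ι := Σ _ : Fin n, X) _ Sigma.snd (fun _ => 0)
    (fun p => a p.1 p.2 • e p.1) fun p => z p.1

theorem LipLIntBound.of_bilIntBound {T : LipLZero 𝕜 X E F} {C : ℝ} (h : BilIntBound (Tbil T) C) :
    LipLIntBound 𝕜 T.1 C := fun n x y e z => by
  have key := h n (fun i => delta 𝕜 (x i) - delta 𝕜 (y i)) e z
  rw [bilWeakSup_eq_opNorm, ← lipWeakSup_eq_opNorm] at key
  simpa only [map_sub, sub_apply, Tbil_delta] using key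

theorem lipLIntBound_iff_bilIntBound_Tbil (T : LipLZero 𝕜 X E F) {C : ℝ} :
    LipLIntBound 𝕜 T.1 C ↔ BilIntBound (Tbil T) C :=
  ⟨.of_lipLIntBound, .of_bilIntBound⟩

theorem isLipLIntegral_iff_isBilIntegral_Tbil (T : LipLZero 𝕜 X E F) :
    IsLipLIntegral 𝕜 T.1 ↔ IsBilIntegral (Tbil T) := by
  simp only [IsLipLIntegral, IsBilIntegral, lipLIntBound_iff_bilIntBound_Tbil]

theorem lipLIntNorm_eq_bilIntNorm_Tbil (T : LipLZero 𝕜 X E F) :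
    lipLIntNorm 𝕜 T.1 = bilIntNorm (Tbil T) := by
  simp only [lipLIntNorm, bilIntNorm, lipLIntBound_iff_bilIntBound_Tbil]

end Correspondence

section Isometry

variable (𝕜 X E F : Type*) [RCLike 𝕜] [MetricSpace X] [Zero X]
  [NormedAddCommGroup E] [NormedSpace 𝕜 E] [NormedAddCommGroup F] [NormedSpace 𝕜 F]

variable {𝕜 X E F} in
/-- The Lip-Linear operator `(x, e) ↦ R(x)(e)`. -/
noncomputable def uncurryLip (R : LipZero 𝕜 X (E →L[𝕜] F)) : LipLZero 𝕜 X E F :=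
  ⟨fun p => R p.1 p.2, ⟨⟨‖R‖ + 1, by have := R.nonneg; positivity, fun x y e =>
      (R x - R y).le_of_opNorm_le
        ((R.norm_sub_le x y).trans (by gcongr; exact le_add_of_nonneg_right zero_le_one)) e⟩,
    fun x => (R x).toLinearMap.isLinear⟩,
    DFunLike.congr_fun R.map_zero⟩

/-- `LipL₀(X × E; F)` is `Lip₀(X; 𝓛(E; F))`, through `T ↦ (x ↦ T(x, ·))`. -/
noncomputable def curryEquiv : LipLZero 𝕜 X E F ≃ₗ[𝕜] LipZero 𝕜 X (E →L[𝕜] F) where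
  toFun := curryLip
  invFun := uncurryLip
  map_add' _ _ := rfl
  map_smul' _ _ := rfl
  left_inv _ := rfl
  right_inv _ := rfl

variable [CompleteSpace F]

/-- `T ↦ T_bil`, as a bijection of `LipL₀(X × E; F)` onto all continuous bilinear operators. -/
noncomputable def TbilLinearEquiv : LipLZero 𝕜 X E F ≃ₗ[𝕜] LipFree 𝕜 X →L[𝕜] E →L[𝕜] F :=
  (curryEquiv 𝕜 X E F).trans (linearizeEquiv 𝕜 X (E →L[𝕜] F)).toLinearEquiv

theorem map_TbilLinearEquiv_lipLIntSubmodule :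
    (lipLIntSubmodule 𝕜 X E F).map (TbilLinearEquiv 𝕜 X E F : LipLZero 𝕜 X E F →ₗ[𝕜] _) =
      bilIntSubmodule 𝕜 (LipFree 𝕜 X) E F := by
  ext B
  obtain ⟨T, rfl⟩ := (TbilLinearEquiv 𝕜 X E F).surjective B
  rw [Submodule.mem_map_equiv, LinearEquiv.symm_apply_apply]
  exact isLipLIntegral_iff_isBilIntegral_Tbil T

/-- `T ↦ T_bil`, as an isometry of `LipL₀^int(X × E; F)` onto `BI(𝓕(X) × E; F)`. -/
noncomputable def TbilIsometryEquiv : LipLInt 𝕜 X E F ≃ₗᵢ[𝕜] BilInt 𝕜 (LipFree 𝕜 X) E F where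
  toLinearEquiv := (TbilLinearEquiv 𝕜 X E F).ofSubmodules (lipLIntSubmodule 𝕜 X E F)
    (bilIntSubmodule 𝕜 (LipFree 𝕜 X) E F) (map_TbilLinearEquiv_lipLIntSubmodule 𝕜 X E F)
  norm_map' T := (lipLIntNorm_eq_bilIntNorm_Tbil T.toLipLZero).symm

end Isometry

section Dual

variable {𝕜 X E : Type*} [RCLike 𝕜] [MetricSpace X] [Zero X]
  [NormedAddCommGroup E] [NormedSpace 𝕜 E]

theorem lipWeakSup_eq_norm_sum_box {n : ℕ} (x y : Fin n → X) (e : Fin n → E)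
    (z : Fin n → StrongDual 𝕜 𝕜) :
    lipWeakSup x y e z = ‖∑ i, box 𝕜 (x i) (y i) (z i 1 • e i)‖ := by
  rw [LipTensor.norm_sum_box, lipWeakSup]
  refine iSup_congr fun p => ?_
  rw [← (toSpanSingletonLIE 𝕜 𝕜).symm.norm_map, toSpanSingletonLIE_symm_apply, sum_apply]
  refine congrArg norm (Finset.sum_congr rfl fun i _ => ?_)
  rw [smul_apply, map_smul, smul_eq_mul, smul_eq_mul, mul_comm (z i 1), mul_assoc]

theorem norm_box_le (x y : X) (e : E) : ‖box 𝕜 x y e‖ ≤ dist x y * ‖e‖ := by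
  refine Real.iSup_le (fun p => ?_) (by positivity)
  rw [toDual_box_elem, norm_mul]
  exact mul_le_mul ((p.1.1.norm_sub_le x y).trans (mul_le_of_le_one_left dist_nonneg p.1.2))
    ((p.2.1.le_opNorm e).trans_eq (by rw [p.2.2, one_mul])) (norm_nonneg _) dist_nonneg

variable (𝕜 E) in
/-- `e ↦ δ_{(x,y)} ⊠ e` as a continuous linear map. -/
noncomputable def boxL (x y : X) : E →L[𝕜] LipTensor 𝕜 X E :=
  LinearMap.mkContinuous
    { toFun := box 𝕜 x y
      map_add' := fun e e' => Subtype.ext (LinearMap.ext fun g => map_add (g x - g y) e e')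
      map_smul' := fun c e => Subtype.ext (LinearMap.ext fun g => map_smul (g x - g y) c e) }
    (dist x y) (norm_box_le x y)

theorem boxL_zero_sub_boxL_zero (x y : X) : boxL 𝕜 E x 0 - boxL 𝕜 E y 0 = boxL 𝕜 E x y :=
  ContinuousLinearMap.ext fun e => Subtype.ext <| LinearMap.ext fun g =>
    DFunLike.congr_fun (sub_sub_sub_cancel_right (g x) (g y) (g 0)) e

variable (𝕜 X E) in
/-- The universal Lip-Linear operator `(x, e) ↦ δ_{(x,0)} ⊠ e`, in curried form. -/
noncomputable def boxLip : LipZero 𝕜 X (E →L[𝕜] LipTensor 𝕜 X E) :=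
  LipZero.mk (fun x => boxL 𝕜 E x 0)
    (ContinuousLinearMap.ext fun e => Subtype.ext <| LinearMap.ext fun g =>
      DFunLike.congr_fun (sub_self (g 0)) e) 1 fun x y => by
      rw [boxL_zero_sub_boxL_zero, one_mul]
      exact LinearMap.mkContinuous_norm_le _ dist_nonneg _

/-- The linear functional `δ_{(x,y)} ⊠ e ↦ T(x, e) - T(y, e)` on `X ⊠ E`. -/
noncomputable def tensorFunctional (T : LipLZero 𝕜 X E 𝕜) : LipTensor 𝕜 X E →ₗ[𝕜] 𝕜 :=
  LipTensor.toDual.flip (curryLip T)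

theorem tensorFunctional_box (T : LipLZero 𝕜 X E 𝕜) (x y : X) (e : E) :
    tensorFunctional T (box 𝕜 x y e) = T.1 (x, e) - T.1 (y, e) :=
  rfl

theorem tensorFunctional_sum_box (T : LipLZero 𝕜 X E 𝕜) {n : ℕ} (x y : Fin n → X)
    (e : Fin n → E) (z : Fin n → StrongDual 𝕜 𝕜) :
    tensorFunctional T (∑ i, box 𝕜 (x i) (y i) (z i 1 • e i)) =
      ∑ i, z i (T.1 (x i, e i) - T.1 (y i, e i)) := by
  rw [map_sum]
  refine Finset.sum_congr rfl fun i _ => ?_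
  have apply_eq_smul (c : 𝕜) : z i c = z i 1 • c := by
    rw [smul_eq_mul, mul_comm, ← smul_eq_mul, ← map_smul, smul_eq_mul, mul_one]
  rw [tensorFunctional_box, (T.2.1.2 _).map_smul, (T.2.1.2 _).map_smul, ← smul_sub,
    apply_eq_smul (T.1 (x i, e i) - T.1 (y i, e i))]

theorem lipLIntBound_iff_norm_tensorFunctional_le (T : LipLZero 𝕜 X E 𝕜) {C : ℝ} :
    LipLIntBound 𝕜 T.1 C ↔ ∀ u, ‖tensorFunctional T u‖ ≤ C * ‖u‖ := by
  simp only [LipLIntBound, lipWeakSup_eq_norm_sum_box, ← tensorFunctional_sum_box]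
  refine ⟨fun h u => ?_, fun h n x y e z => h _⟩
  obtain ⟨n, x, y, e, rfl⟩ := u.exists_rep
  simpa only [ContinuousLinearMap.id_apply, one_smul] using
    h n x y e fun _ => ContinuousLinearMap.id 𝕜 𝕜

/-- The Lip-Linear operator `(x, e) ↦ φ(δ_{(x,0)} ⊠ e)`. -/
noncomputable def operatorOfFunctional (φ : StrongDual 𝕜 (LipTensor 𝕜 X E)) : LipLZero 𝕜 X E 𝕜 :=
  uncurryLip <| LipZero.mk (fun x => φ ∘L boxLip 𝕜 X E x)
    (by rw [LipZero.map_zero, comp_zero]) (‖φ‖ * ‖boxLip 𝕜 X E‖) fun x y => by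
      rw [← comp_sub, mul_assoc]
      exact φ.opNorm_comp_le _ |>.trans (by gcongr; exact LipZero.norm_sub_le _ x y)

theorem tensorFunctional_operatorOfFunctional (φ : StrongDual 𝕜 (LipTensor 𝕜 X E)) :
    tensorFunctional (operatorOfFunctional φ) = φ := by
  ext u
  obtain ⟨n, x, y, e, rfl⟩ := u.exists_rep
  simp only [map_sum, tensorFunctional_box]
  refine Finset.sum_congr rfl fun i _ => ?_
  exact (map_sub φ _ _).symm.trans
    (congrArg φ (DFunLike.congr_fun (boxL_zero_sub_boxL_zero (x i) (y i)) (e i)))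

theorem lipLIntBound_operatorOfFunctional_iff (φ : StrongDual 𝕜 (LipTensor 𝕜 X E)) {C : ℝ}
    (hC : 0 ≤ C) : LipLIntBound 𝕜 (operatorOfFunctional φ).1 C ↔ ‖φ‖ ≤ C := by
  rw [lipLIntBound_iff_norm_tensorFunctional_le, tensorFunctional_operatorOfFunctional,
    opNorm_le_iff hC]
  rfl

theorem isLipLIntegral_operatorOfFunctional (φ : StrongDual 𝕜 (LipTensor 𝕜 X E)) :
    IsLipLIntegral 𝕜 (operatorOfFunctional φ).1 :=
  ⟨‖φ‖ + 1, by positivity, (lipLIntBound_operatorOfFunctional_iff φ (by positivity)).2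
    (le_add_of_nonneg_right zero_le_one)⟩

theorem lipLIntNorm_operatorOfFunctional (φ : StrongDual 𝕜 (LipTensor 𝕜 X E)) :
    lipLIntNorm 𝕜 (operatorOfFunctional φ).1 = ‖φ‖ := by
  refine Eq.trans (congrArg sInf ?_) (csInf_Ioi_inter_Ici (norm_nonneg φ))
  exact Set.ext fun C => and_congr_right fun hC => lipLIntBound_operatorOfFunctional_iff φ hC.le

theorem exists_norm_tensorFunctional_le (T : LipLInt 𝕜 X E 𝕜) :
    ∃ C, ∀ u, ‖tensorFunctional T.toLipLZero u‖ ≤ C * ‖u‖ :=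
  T.2.imp fun _ hC => (lipLIntBound_iff_norm_tensorFunctional_le T.toLipLZero).1 hC.2

variable (𝕜 X E) in
/-- `φ ↦ ((x, e) ↦ φ(δ_{(x,0)} ⊠ e))`, as an isometry of `(X ⊠ E)*` onto `LipL₀^int(X × E; 𝕜)`. -/
noncomputable def dualIsometryEquiv :
    StrongDual 𝕜 (LipTensor 𝕜 X E) ≃ₗᵢ[𝕜] LipLInt 𝕜 X E 𝕜 where
  toFun φ := ⟨operatorOfFunctional φ, isLipLIntegral_operatorOfFunctional φ⟩
  invFun T := (tensorFunctional T.toLipLZero).mkContinuousOfExistsBound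
    (exists_norm_tensorFunctional_le T)
  map_add' _ _ := rfl
  map_smul' _ _ := rfl
  left_inv φ := ContinuousLinearMap.coe_injective (tensorFunctional_operatorOfFunctional φ)
  right_inv T := Subtype.ext <| Subtype.ext <| funext fun p => by
    change T.1.1 (p.1, p.2) - T.1.1 (0, p.2) = T.1.1 p
    rw [T.1.2.2, sub_zero]
  norm_map' := lipLIntNorm_operatorOfFunctional

end Dual

theorem mainTheorem4_general (𝕜 X E F : Type*) [RCLike 𝕜] [MetricSpace X] [Zero X]
    [NormedAddCommGroup E] [NormedSpace 𝕜 E]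
    [NormedAddCommGroup F] [NormedSpace 𝕜 F] [CompleteSpace F] :
    (∀ T : LipLZero 𝕜 X E F,
      (IsLipLIntegral 𝕜 T.1 ↔ IsBilIntegral (Tbil T)) ∧
      (IsLipLIntegral 𝕜 T.1 → lipLIntNorm 𝕜 T.1 = bilIntNorm (Tbil T))) ∧
    (∃ Φ : LipLInt 𝕜 X E F ≃ₗᵢ[𝕜] BilInt 𝕜 (LipFree 𝕜 X) E F,
      ∀ T : LipLInt 𝕜 X E F, (Φ T).toBilinear = Tbil T.toLipLZero) ∧
    (∃ Ψ : StrongDual 𝕜 (InjLipTensor 𝕜 X E) ≃ₗᵢ[𝕜] LipLInt 𝕜 X E 𝕜,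
      ∀ (φ : StrongDual 𝕜 (InjLipTensor 𝕜 X E)) (x : X) (e : E),
        (Ψ φ).toLipLZero.1 (x, e) = φ (box 𝕜 x 0 e : LipTensor 𝕜 X E)) :=
  ⟨fun T => ⟨isLipLIntegral_iff_isBilIntegral_Tbil T, fun _ => lipLIntNorm_eq_bilIntNorm_Tbil T⟩,
    ⟨TbilIsometryEquiv 𝕜 X E F, fun _ => rfl⟩,
    ⟨(completionRestrictEquiv 𝕜 (LipTensor 𝕜 X E) 𝕜).trans (dualIsometryEquiv 𝕜 X E),
      fun _ _ _ => rfl⟩⟩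

end LipLin

open LipLin in
theorem mainTheorem4 (𝕜 X E F : Type*) [RCLike 𝕜] [MetricSpace X] [Zero X]
    [NormedAddCommGroup E] [NormedSpace 𝕜 E] [CompleteSpace E]
    [NormedAddCommGroup F] [NormedSpace 𝕜 F] [CompleteSpace F] :
    (∀ T : LipLZero 𝕜 X E F,
      (IsLipLIntegral 𝕜 T.1 ↔ IsBilIntegral (Tbil T)) ∧
      (IsLipLIntegral 𝕜 T.1 → lipLIntNorm 𝕜 T.1 = bilIntNorm (Tbil T))) ∧
    (∃ Φ : LipLInt 𝕜 X E F ≃ₗᵢ[𝕜] BilInt 𝕜 (LipFree 𝕜 X) E F,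
      ∀ T : LipLInt 𝕜 X E F, (Φ T).toBilinear = Tbil T.toLipLZero) ∧
    (∃ Ψ : StrongDual 𝕜 (InjLipTensor 𝕜 X E) ≃ₗᵢ[𝕜] LipLInt 𝕜 X E 𝕜,
      ∀ (φ : StrongDual 𝕜 (InjLipTensor 𝕜 X E)) (x : X) (e : E),
        (Ψ φ).toLipLZero.1 (x, e) = φ (box 𝕜 x 0 e : LipTensor 𝕜 X E)) := by
  exact mainTheorem4_general 𝕜 X E F
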